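/- Let $n>1$ be an integer, let $M_n$ be the algebra of complex $n\times n$ matrices with rows and columns indexed by $\mathbb Z_n=\mathbb Z/n\mathbb Z$, let $(e_j)_{j\in\mathbb Z_n}$ be the standard basis of $\mathbb C^n$, and put $z=\exp(2\pi i/n)$. Define $U,V\in M_n$ by $Ue_j=e_{j+1}$ and $Ve_j=z^je_j$. The matrices $\tfrac1{\sqrt n}U^aV^b$ ($a,b\in\mathbb Z_n$) form an orthonormal basis $\mathcal W$ of $M_n$ for the inner product $\langle A,B\rangle=\operatorname{tr}(AB^*)$, called the Weyl basis. Let $M_n^d$ be the vector space dual of $M_n$, and let $\mathcal D_{\mathcal W}:M_n\to M_n^d$ be the duality map, that is, the linear isomorphism taking each member of $\mathcal W$ to the corresponding member of its dual basis. Order these spaces as follows. An element of $M_p(M_n)$ is positive if it is positive semidefinite as a complex $pn\times pn$ block matrix. An element $(f_{k,l})$ of $M_p(M_n^d)$ is positive if the linear map $M_n\to M_p$, $X\mapsto (f_{k,l}(X))_{k,l}$, is completely positive. A linear map $\Phi$ between two such spaces is completely positive if, for every $p$, the map $(v_{k,l})\mapsto(\Phi(v_{k,l}))$ takes positive $p\times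 p$ matrices to positive $p\times p$ matrices, and positive if this holds for $p=1$. An invertible linear map $\Phi$ is a complete order isomorphism (respectively, an order isomorphism) if $\Phi$ and $\Phi^{-1}$ are both completely positive (respectively, both positive). Then $\mathcal D_{\mathcal W}$ is a complete order isomorphism if $n=2$, and $\mathcal D_{\mathcal W}$ is not an order isomorphism if $n>2$. -/

import Mathlib

noncomputable section

namespace WeylDuality

open Matrix
open scoped ComplexOrder

/-! ### Matrix orderings and completely positive maps -/

/-- The data of a matrix ordering on `V`: for every `p` the set of positive elements of `M_p(V)`. -/
abbrev MatrixCones (V : Type*) := ∀ p : ℕ, Set (Matrix (Fin p) (Fin p) V)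

/-- `Φ` is completely positive: for each `p` the amplification `(v i j) ↦ (Φ (v i j))` sends
positive elements of `M_p(V)` to positive elements of `M_p(W)`. -/
def IsCompletelyPositive {V W : Type*} [AddCommGroup V] [Module ℂ V] [AddCommGroup W] [Module ℂ W]
    (C : MatrixCones V) (D : MatrixCones W) (Φ : V →ₗ[ℂ] W) : Prop :=
  ∀ (p : ℕ) (A : Matrix (Fin p) (Fin p) V), A ∈ C p → A.map Φ ∈ D p

/-- `Φ` is positive: it sends positive elements of `V = M_1(V)` to positive elements of
`W = M_1(W)`. -/
def IsPositiveMap {V W : Type*} [AddCommGroup V] [Module ℂ V] [AddCommGroup W] [Module ℂ W]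
    (C : MatrixCones V) (D : MatrixCones W) (Φ : V →ₗ[ℂ] W) : Prop :=
  ∀ v : V, (Matrix.of fun _ _ => v) ∈ C 1 → (Matrix.of fun _ _ => Φ v) ∈ D 1

/-- An order isomorphism: an invertible linear map that is positive with positive inverse. -/
def IsOrderIsomorphism {V W : Type*} [AddCommGroup V] [Module ℂ V] [AddCommGroup W] [Module ℂ W]
    (C : MatrixCones V) (D : MatrixCones W) (e : V ≃ₗ[ℂ] W) : Prop :=
  IsPositiveMap C D e.toLinearMap ∧ IsPositiveMap D C e.symm.toLinearMap

/-- A complete order isomorphism: an invertible linear map that is completely positive with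
completely positive inverse. -/
def IsCompleteOrderIsomorphism {V W : Type*} [AddCommGroup V] [Module ℂ V]
    [AddCommGroup W] [Module ℂ W]
    (C : MatrixCones V) (D : MatrixCones W) (e : V ≃ₗ[ℂ] W) : Prop :=
  IsCompletelyPositive C D e.toLinearMap ∧ IsCompletelyPositive D C e.symm.toLinearMap

/-- The standard matrix ordering of the algebra of complex matrices with index set `m`: an element
of `M_p(M_m)` is positive when the block matrix of scalars that it defines is positive
semidefinite. -/
def matrixAlgebraCones (m : Type*) : MatrixCones (Matrix m m ℂ) := fun p =>
  {A | (Matrix.comp (Fin p) (Fin p) m m ℂ A).PosSemidef}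

/-- The linear map `V → M_p`, `v ↦ (f i j v)`, given by a matrix of functionals. -/
def functionalMatrixMap {V : Type*} [AddCommGroup V] [Module ℂ V] {p : ℕ}
    (f : Matrix (Fin p) (Fin p) (Module.Dual ℂ V)) : V →ₗ[ℂ] Matrix (Fin p) (Fin p) ℂ where
  toFun v := Matrix.of fun i j => f i j v
  map_add' v w := by ext i j; simp
  map_smul' c v := by ext i j; simp

/-- The dual matrix ordering: a matrix of functionals is positive when the associated linear map
`V → M_p` is completely positive. -/
def dualCones {V : Type*} [AddCommGroup V] [Module ℂ V] (C : MatrixCones V) :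
    MatrixCones (Module.Dual ℂ V) := fun p =>
  {f | IsCompletelyPositive C (matrixAlgebraCones (Fin p)) (functionalMatrixMap f)}

/-! ### The duality map of a basis -/

/-- The linear isomorphism of `V` onto its dual space that takes each member of the basis `b` to
the corresponding member of the dual basis. -/
def dualityMap {ι V : Type*} [Finite ι] [DecidableEq ι] [AddCommGroup V] [Module ℂ V]
    (b : Module.Basis ι ℂ V) : V ≃ₗ[ℂ] Module.Dual ℂ V :=
  b.equiv b.dualBasis (Equiv.refl ι)

/-! ### The Weyl basis of `M_n`, with rows and columns indexed by `ℤ/n` -/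

/-- `z = exp (2πi/n)`. -/
def rootOfUnity (n : ℕ) : ℂ := Complex.exp (2 * Real.pi * Complex.I / n)

/-- The shift matrix: `U e_j = e_{j+1}`. -/
def shiftMatrix (n : ℕ) : Matrix (ZMod n) (ZMod n) ℂ :=
  Matrix.of fun i j => if i = j + 1 then 1 else 0

/-- The clock matrix: `V e_j = z ^ j e_j`. -/
def clockMatrix (n : ℕ) : Matrix (ZMod n) (ZMod n) ℂ :=
  Matrix.diagonal fun j => rootOfUnity n ^ j.val

/-- The matrices `n^{-1/2} U^a V^b`, for `a, b ∈ ℤ/n`. -/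
def weylMatrix (n : ℕ) [NeZero n] (ab : ZMod n × ZMod n) : Matrix (ZMod n) (ZMod n) ℂ :=
  ((Real.sqrt n : ℝ) : ℂ)⁻¹ • (shiftMatrix n ^ ab.1.val * clockMatrix n ^ ab.2.val)

theorem shiftMatrix_pow (n : ℕ) [NeZero n] (k : ℕ) (i j : ZMod n) :
    (shiftMatrix n ^ k) i j = if i = j + (k : ZMod n) then 1 else 0 := by
  induction k generalizing i j with
  | zero => simp [Matrix.one_apply]
  | succ k ih =>
    have hS : ∀ x : ZMod n, shiftMatrix n x j = if x = j + 1 then 1 else 0 := fun _ => rfl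
    rw [pow_succ, Matrix.mul_apply]
    simp only [ih, hS, mul_ite, mul_one, mul_zero, Finset.sum_ite_eq', Finset.mem_univ, if_true]
    push_cast
    rw [show j + 1 + (k : ZMod n) = j + (k + 1) by ring]

theorem weylMatrix_apply (n : ℕ) [NeZero n] (ab : ZMod n × ZMod n) (i j : ZMod n) :
    weylMatrix n ab i j = ((Real.sqrt n : ℝ) : ℂ)⁻¹ *
      (if i = j + ab.1 then (rootOfUnity n ^ ab.2.val) ^ j.val else 0) := by
  simp only [weylMatrix, Matrix.smul_apply, smul_eq_mul, clockMatrix, Matrix.diagonal_pow,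
    Matrix.mul_diagonal, shiftMatrix_pow, Pi.pow_apply, ZMod.natCast_val, ZMod.cast_id', id]
  congr 1
  split_ifs
  · rw [one_mul, ← pow_mul, ← pow_mul, mul_comm]
  · rw [zero_mul]

theorem sum_zmod_pow (n : ℕ) [NeZero n] (w : ℂ) :
    ∑ j : ZMod n, w ^ j.val = ∑ i ∈ Finset.range n, w ^ i := by
  obtain ⟨k, rfl⟩ := Nat.exists_eq_succ_of_ne_zero (NeZero.ne n)
  exact Fin.sum_univ_eq_sum_range (fun i => w ^ i) (k + 1)

/-- The Weyl matrices are orthonormal for the Hilbert-Schmidt inner product `tr (A B*)`. -/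
theorem weylMatrix_orthonormal (n : ℕ) [NeZero n] (ab cd : ZMod n × ZMod n) :
    (weylMatrix n ab * (weylMatrix n cd)ᴴ).trace = if ab = cd then 1 else 0 := by
  have hn : (n : ℂ) ≠ 0 := Nat.cast_ne_zero.mpr (NeZero.ne n)
  have hz : IsPrimitiveRoot (rootOfUnity n) n := Complex.isPrimitiveRoot_exp n (NeZero.ne n)
  have hz0 : rootOfUnity n ≠ 0 := Complex.exp_ne_zero _
  have hconj : star (rootOfUnity n) = (rootOfUnity n)⁻¹ := by
    have h1 : ‖rootOfUnity n‖ = 1 := hz.norm'_eq_one (NeZero.ne n)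
    rw [Complex.inv_def, Complex.normSq_eq_norm_sq, h1]
    simp
  have hs : ((Real.sqrt n : ℝ) : ℂ)⁻¹ * star (((Real.sqrt n : ℝ) : ℂ)⁻¹) = (n : ℂ)⁻¹ := by
    rw [star_inv₀, ← mul_inv, Complex.star_def, Complex.conj_ofReal, ← Complex.ofReal_mul,
      Real.mul_self_sqrt (Nat.cast_nonneg n), Complex.ofReal_natCast]
  obtain ⟨a, b⟩ := ab
  obtain ⟨c, d⟩ := cd
  set w : ℂ := rootOfUnity n ^ b.val * (rootOfUnity n ^ d.val)⁻¹ with hw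
  have key : (weylMatrix n (a, b) * (weylMatrix n (c, d))ᴴ).trace
      = if a = c then (n : ℂ)⁻¹ * ∑ j : ZMod n, w ^ j.val else 0 := by
    simp only [Matrix.trace, Matrix.diag_apply, Matrix.mul_apply, Matrix.conjTranspose_apply,
      weylMatrix_apply]
    rw [Finset.sum_comm]
    have : ∀ j i : ZMod n,
        ((Real.sqrt n : ℝ) : ℂ)⁻¹ * (if i = j + a then (rootOfUnity n ^ b.val) ^ j.val else 0) *
          star (((Real.sqrt n : ℝ) : ℂ)⁻¹ *
            (if i = j + c then (rootOfUnity n ^ d.val) ^ j.val else 0))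
        = if i = j + a then (if a = c then (n : ℂ)⁻¹ * w ^ j.val else 0) else 0 := by
      intro j i
      by_cases h : i = j + a
      · by_cases h' : a = c
        · subst h'
          simp only [h, if_true]
          rw [star_mul', star_pow, star_pow, hconj, ← hs, hw]
          simp only [mul_pow, inv_pow]
          ring
        · have : ¬ (i = j + c) := by rw [h]; simpa using h'
          simp [h, h']
      · simp [h]
    simp only [this, Finset.sum_ite_eq', Finset.mem_univ, if_true]
    split_ifs
    · rw [Finset.mul_sum]
    · simp
  rw [key, sum_zmod_pow]
  by_cases hac : a = c
  · by_cases hbd : b = d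
    · have hw1 : w = 1 := by
        rw [hw, hbd, mul_inv_cancel₀ (pow_ne_zero _ hz0)]
      simp [hac, hbd, hw1, hn]
    · have hw1 : w ≠ 1 := by
        intro h
        apply hbd
        apply ZMod.val_injective n
        rw [hw, mul_inv_eq_one₀ (pow_ne_zero _ hz0)] at h
        exact hz.pow_inj (ZMod.val_lt b) (ZMod.val_lt d) h
      have hwn : w ^ n = 1 := by
        rw [hw, mul_pow, inv_pow, ← pow_mul, ← pow_mul, mul_comm, pow_mul', mul_comm, pow_mul',
          hz.pow_eq_one]
        simp
      rw [geom_sum_eq hw1, hwn]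
      simp [hbd]
  · simp [hac]

theorem weylMatrix_linearIndependent (n : ℕ) [NeZero n] :
    LinearIndependent ℂ (weylMatrix n) := by
  rw [Fintype.linearIndependent_iff]
  intro g hg cd
  have h := congrArg (fun A => (A * (weylMatrix n cd)ᴴ).trace) hg
  simpa [Finset.sum_mul, Matrix.trace_sum, weylMatrix_orthonormal] using h

/-- The Weyl basis `{n^{-1/2} U^a V^b}` of `M_n`. -/
def weylBasis (n : ℕ) [NeZero n] :
    Module.Basis (ZMod n × ZMod n) ℂ (Matrix (ZMod n) (ZMod n) ℂ) :=
  basisOfLinearIndependentOfCardEqFinrank (weylMatrix_linearIndependent n)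
    (by simp [Module.finrank_matrix])

theorem weylBasis_apply (n : ℕ) [NeZero n] (ab : ZMod n × ZMod n) :
    weylBasis n ab = weylMatrix n ab := by
  simp [weylBasis]

end WeylDuality

end

namespace WeylDuality

open Matrix
open scoped ComplexOrder

theorem star_rootOfUnity_pow (n : ℕ) [NeZero n] (d j : ZMod n) :
    star ((rootOfUnity n ^ d.val) ^ j.val) = (rootOfUnity n ^ d.val) ^ (-j).val := by
  have hz : IsPrimitiveRoot (rootOfUnity n) n := Complex.isPrimitiveRoot_exp n (NeZero.ne n)
  have hz0 : rootOfUnity n ≠ 0 := Complex.exp_ne_zero _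
  have hconj : star (rootOfUnity n) = (rootOfUnity n)⁻¹ := by
    have h1 : ‖rootOfUnity n‖ = 1 := hz.norm'_eq_one (NeZero.ne n)
    rw [Complex.inv_def, Complex.normSq_eq_norm_sq, h1]
    simp
  rw [star_pow, star_pow, hconj, inv_pow, inv_pow, inv_eq_iff_eq_inv, ← mul_eq_one_iff_eq_inv₀
    (pow_ne_zero _ (pow_ne_zero _ hz0)), ← pow_add, ← pow_mul, hz.pow_eq_one_iff_dvd]
  refine Dvd.dvd.mul_left ?_ _
  rw [← ZMod.natCast_eq_zero_iff]
  simp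

theorem star_weylMatrix_apply (n : ℕ) [NeZero n] (cd : ZMod n × ZMod n) (i j : ZMod n) :
    star (weylMatrix n cd i j) = weylMatrix n cd (i - 2 * j) (-j) := by
  have h : (i - 2 * j = -j + cd.1) ↔ i = j + cd.1 := by
    constructor <;> intro h <;> linear_combination h
  rw [weylMatrix_apply, weylMatrix_apply]
  simp only [h]
  split_ifs
  · rw [star_mul', star_rootOfUnity_pow, star_inv₀, Complex.star_def, Complex.conj_ofReal]
  · simp

/-- The duality map of the Weyl basis in terms of matrix entries. -/
theorem dualityMap_weylBasis_apply (n : ℕ) [NeZero n] (A X : Matrix (ZMod n) (ZMod n) ℂ) :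
    dualityMap (weylBasis n) A X = ∑ i, ∑ j, A i j * X (i - 2 * j) (-j) := by
  let B : Matrix (ZMod n) (ZMod n) ℂ →ₗ[ℂ] Matrix (ZMod n) (ZMod n) ℂ →ₗ[ℂ] ℂ :=
    LinearMap.mk₂ ℂ (fun A X => ∑ i, ∑ j, A i j * X (i - 2 * j) (-j))
      (by intros; simp [add_mul, Finset.sum_add_distrib])
      (by intros; simp [Finset.mul_sum, mul_assoc])
      (by intros; simp [mul_add, Finset.sum_add_distrib])
      (by intros; simp [Finset.mul_sum, mul_left_comm])
  have hB : (dualityMap (weylBasis n)).toLinearMap = B := by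
    refine (weylBasis n).ext fun ab => (weylBasis n).ext fun cd => ?_
    have h := weylMatrix_orthonormal n ab cd
    simp only [Matrix.trace, Matrix.diag_apply, Matrix.mul_apply, Matrix.conjTranspose_apply,
      star_weylMatrix_apply] at h
    have hr : B (weylBasis n ab) (weylBasis n cd) = if ab = cd then 1 else 0 := by
      simpa [B, weylBasis_apply] using h
    rw [hr]
    simp [dualityMap, Module.Basis.equiv_apply, Finsupp.single_apply, eq_comm]
  exact congrArg (fun L => L A X) hB

/-- For `n = 2` the duality map sends the matrix units to their dual basis. -/
theorem dualityMap_weylBasis_two_apply (A X : Matrix (ZMod 2) (ZMod 2) ℂ) :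
    dualityMap (weylBasis 2) A X = ∑ i, ∑ j, A i j * X i j := by
  rw [dualityMap_weylBasis_apply]
  refine Finset.sum_congr rfl fun i _ => Finset.sum_congr rfl fun j _ => ?_
  rw [show (2 : ZMod 2) = 0 from rfl, ZMod.neg_eq_self_mod_two, zero_mul, sub_zero]

/-- A matrix of functionals whose matrix of densities is positive is positive. -/
theorem mem_dualCones_of_density {m : Type*} [Fintype m] {p : ℕ}
    (A : Matrix (Fin p) (Fin p) (Matrix m m ℂ))
    (hA : A ∈ matrixAlgebraCones m p)
    (f : Matrix (Fin p) (Fin p) (Module.Dual ℂ (Matrix m m ℂ)))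
    (hf : ∀ r s X, f r s X = ∑ k, ∑ l, A r s k l * X k l) :
    f ∈ dualCones (matrixAlgebraCones m) p := by
  intro q X hX
  let K : Matrix ((Fin q × Fin p) × m) ((Fin q × Fin p) × m) ℂ :=
    Matrix.of fun x y => A x.1.2 y.1.2 x.2 y.2 * X x.1.1 y.1.1 x.2 y.2
  have hK : K.PosSemidef := (Matrix.PosSemidef.kronecker hA hX).submatrix
    (fun x : (Fin q × Fin p) × m => ((x.1.2, x.2), (x.1.1, x.2)))
  let S : Matrix ((Fin q × Fin p) × m) (Fin q × Fin p) ℂ :=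
    Matrix.of fun x y => if x.1 = y then 1 else 0
  have key : Matrix.comp _ _ _ _ ℂ (X.map (functionalMatrixMap f)) = Sᴴ * K * S := by
    ext x y
    simp only [S, Matrix.mul_apply, Fintype.sum_prod_type_right (α₂ := m),
      Matrix.conjTranspose_apply, Matrix.of_apply, apply_ite star, star_one, star_zero, ite_mul,
      mul_ite, one_mul, mul_one, zero_mul, mul_zero, Finset.sum_ite_eq', Finset.mem_univ, if_true]
    rw [Finset.sum_comm]
    simp [K, functionalMatrixMap, hf]
  change Matrix.PosSemidef _
  rw [key]
  exact hK.conjTranspose_mul_mul_same S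

/-- The density matrix of a positive matrix of functionals is positive. -/
theorem density_mem_matrixAlgebraCones {m : Type*} [Fintype m] [DecidableEq m] {p : ℕ}
    (f : Matrix (Fin p) (Fin p) (Module.Dual ℂ (Matrix m m ℂ)))
    (hf : f ∈ dualCones (matrixAlgebraCones m) p)
    (A : Matrix (Fin p) (Fin p) (Matrix m m ℂ))
    (hA : ∀ r s k l, A r s k l = f r s (Matrix.single k l 1)) :
    A ∈ matrixAlgebraCones m p := by
  let e := (Fintype.equivFin m).symm
  let v : Fin (Fintype.card m) × m → ℂ := fun x => if e x.1 = x.2 then 1 else 0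
  have hE : (Matrix.of fun t u => Matrix.single (e t) (e u) (1 : ℂ)) ∈
      matrixAlgebraCones m (Fintype.card m) := by
    change Matrix.PosSemidef _
    convert Matrix.posSemidef_vecMulVec_self_star v using 1
    ext ⟨t, k⟩ ⟨u, l⟩
    by_cases h₁ : e t = k <;> by_cases h₂ : e u = l <;>
      simp [v, Matrix.vecMulVec_apply, h₁, h₂]
  have h := (hf _ _ hE).submatrix (fun x : Fin p × m => (e.symm x.2, x.1))
  change Matrix.PosSemidef _
  convert h using 1
  ext ⟨r, k⟩ ⟨s, l⟩
  simp [hA, functionalMatrixMap]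

theorem dualityMap_weylBasis_two_isCompleteOrderIsomorphism :
    IsCompleteOrderIsomorphism (matrixAlgebraCones (ZMod 2))
      (dualCones (matrixAlgebraCones (ZMod 2))) (dualityMap (weylBasis 2)) := by
  refine ⟨fun p A hA => mem_dualCones_of_density A hA _ fun r s X =>
    dualityMap_weylBasis_two_apply _ _, fun p f hf =>
    density_mem_matrixAlgebraCones f hf _ fun r s k l => ?_⟩
  have h := dualityMap_weylBasis_two_apply ((dualityMap (weylBasis 2)).symm (f r s))
    (Matrix.single k l 1)
  rw [LinearEquiv.apply_symm_apply] at h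
  rw [h]
  simp [Matrix.single_apply, ite_and]

/-- Rank-one positive matrices are positive elements of `M_1(M_m)`. -/
theorem vecMulVec_self_star_mem_matrixAlgebraCones {m : Type*} [Fintype m] (v : m → ℂ) :
    (Matrix.of fun _ _ => Matrix.vecMulVec v (star v)) ∈ matrixAlgebraCones m 1 :=
  (Matrix.posSemidef_vecMulVec_self_star v).submatrix Prod.snd

theorem nonneg_of_mem_dualCones {V : Type*} [AddCommGroup V] [Module ℂ V] {C : MatrixCones V}
    {f : Module.Dual ℂ V} (hf : (Matrix.of fun _ _ => f) ∈ dualCones C 1) {v : V}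
    (hv : (Matrix.of fun _ _ => v) ∈ C 1) : 0 ≤ f v :=
  (hf 1 _ hv).diag_nonneg (i := (0, 0))

theorem not_isPositiveMap_dualityMap_weylBasis (n : ℕ) [NeZero n] (hn : 2 < n) :
    ¬ IsPositiveMap (matrixAlgebraCones (ZMod n)) (dualCones (matrixAlgebraCones (ZMod n)))
      (dualityMap (weylBasis n)).toLinearMap := by
  intro hpos
  have : Fact (1 < n) := ⟨by omega⟩
  have : Fact (2 < n) := ⟨hn⟩
  have h10 : (1 : ZMod n) ≠ 0 := one_ne_zero
  have hneg : (-1 : ZMod n) ≠ 1 := ZMod.neg_one_ne_one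
  let v : ZMod n → ℂ := Pi.single 0 1 + Pi.single 1 1
  let w : ZMod n → ℂ := Pi.single 0 1 + Pi.single 1 Complex.I
  have h := nonneg_of_mem_dualCones (hpos _ (vecMulVec_self_star_mem_matrixAlgebraCones v))
    (vecMulVec_self_star_mem_matrixAlgebraCones w)
  have hval : dualityMap (weylBasis n) (Matrix.vecMulVec v (star v))
      (Matrix.vecMulVec w (star w)) = 1 + Complex.I := by
    have hv (F : ZMod n → ℂ) : ∑ i, v i * F i = F 0 + F 1 := by
      simp [v, Pi.single_apply, add_mul, Finset.sum_add_distrib]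
    have hv' (F : ZMod n → ℂ) : ∑ i, star v i * F i = F 0 + F 1 := by
      have hs : star v = v := by simp [v, Pi.star_single]
      rw [hs, hv]
    have hw : star w (-1) = 0 ∧ w (1 - 2) = 0 := by
      rw [show (1 - 2 : ZMod n) = -1 by ring]
      simp [w, hneg, h10]
    rw [dualityMap_weylBasis_apply]
    simp only [Matrix.vecMulVec_apply, mul_assoc, ← Finset.mul_sum, hv, hv', mul_zero, sub_zero,
      neg_zero, mul_one, hw.1, add_zero]
    simp [w, h10, h10.symm]
  have h' : 0 ≤ dualityMap (weylBasis n) (Matrix.vecMulVec v (star v))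
      (Matrix.vecMulVec w (star w)) := h
  rw [hval, Complex.le_def] at h'
  simp at h'

end WeylDuality

theorem mainTheorem5 (n : ℕ) [NeZero n] :
    (n = 2 → WeylDuality.IsCompleteOrderIsomorphism
      (WeylDuality.matrixAlgebraCones (ZMod n))
      (WeylDuality.dualCones (WeylDuality.matrixAlgebraCones (ZMod n)))
      (WeylDuality.dualityMap (WeylDuality.weylBasis n))) ∧
    (2 < n → ¬ WeylDuality.IsOrderIsomorphism
      (WeylDuality.matrixAlgebraCones (ZMod n))
      (WeylDuality.dualCones (WeylDuality.matrixAlgebraCones (ZMod n)))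
      (WeylDuality.dualityMap (WeylDuality.weylBasis n))) := by
  refine ⟨fun hn => ?_, fun hn h =>
    WeylDuality.not_isPositiveMap_dualityMap_weylBasis n hn h.1⟩
  subst hn
  exact WeylDuality.dualityMap_weylBasis_two_isCompleteOrderIsomorphism
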